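/- Let $\mathcal X$ be a measurable space. For $f:\mathcal X^n\to\mathbb R$ bounded and measurable, $k\in\{1,\dots,n\}$ and $y,y'\in\mathcal X$ let $$D^k_{y,y'}f(\mathbf x)=f(x_1,\dots,x_{k-1},y,x_{k+1},\dots,x_n)-f(x_1,\dots,x_{k-1},y',x_{k+1},\dots,x_n),$$ $$M(f)=\max_k\sup_{\mathbf x,y,y'}D^k_{y,y'}f(\mathbf x),\qquad J(f)=n\max_{l\ne k}\sup_{\mathbf x,z,z',y,y'}D^l_{z,z'}D^k_{y,y'}f(\mathbf x)$$ (with $J(f)=0$ if $n=1$). For real $a,b$ say that $f$ has $(a,b)$-weak interactions if $M(f)\le a/n$ and $J(f)\le b/n$. For a real random variable $W$ with standard deviation $\sigma(W)$ let $$d_{\mathcal N}(W)=\sup\Big\{\Big|E\Big[h\Big(\tfrac{W-E[W]}{\sigma(W)}\Big)\Big]-E[h(Z)]\Big| : h:\mathbb R\to\mathbb R\text{ Lipschitz with constant }1\Big\},\qquad Z\sim\mathcal N(0,1).$$ Let $C>0$, $p\ge 1/2$ and $a,b\in\mathbb R$. (i) Let $n\ge1$, let $\mathbf X=(X_1,\dots,X_n)$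 be independent (not necessarily identically distributed) random variables with values in $\mathcal X$, and let $f:\mathcal X^n\to\mathbb R$ be bounded and measurable. If $f$ has $(a,b)$-weak interactions and $\sigma(f(\mathbf X))\ge Cn^{-p}$, then $$d_{\mathcal N}(f(\mathbf X))\le\frac{Ca(a+b)+a^3}{C^3\,n^{2-3p}}.$$ (ii) Suppose in addition that $p<2/3$. Let $X_1,X_2,\dots$ be independent random variables with values in $\mathcal X$ and let $f_n:\mathcal X^n\to\mathbb R$, $n\ge2$, be bounded and measurable, such that for every $n\ge 2$, $f_n$ has $(a,b)$-weak interactions and $\sigma(f_n(X_1,\dots,X_n))\ge Cn^{-p}$. Then $d_{\mathcal N}(f_n(X_1,\dots,X_n))\to0$ as $n\to\infty$, i.e. the standardized variables $\big(f_n(X_1,\dots,X_n)-E[f_n(X_1,\dots,X_n)]\big)/\sigma(f_n(X_1,\dots,X_n))$ converge to a standard normal variable in the Wasserstein metric (with the rate given by (i)). -/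

import Mathlib

namespace WeakInteractions

open MeasureTheory ProbabilityTheory
open scoped ENNReal

noncomputable section

/-- The partial difference operator `D^k_{y,y'}`: the difference of the values of `f` when the
`k`-th coordinate of `x` is replaced by `y` and by `y'`. -/
def partialDiff {n : ℕ} {𝓧 : Type*} (k : Fin n) (y y' : 𝓧) (f : (Fin n → 𝓧) → ℝ) :
    (Fin n → 𝓧) → ℝ :=
  fun x => f (Function.update x k y) - f (Function.update x k y')

/-- Membership in the algebra `𝒜ₙ` of bounded measurable functions `𝓧ⁿ → ℝ`. -/
def IsBoundedMeasurable {n : ℕ} {𝓧 : Type*} [MeasurableSpace 𝓧] (f : (Fin n → 𝓧) → ℝ) : Prop :=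
  Measurable f ∧ ∃ B : ℝ, ∀ x, |f x| ≤ B

/-- The seminorm `M(f)`, the largest first partial difference, for bounded `f`. -/
def seminormM {n : ℕ} {𝓧 : Type*} (f : (Fin n → 𝓧) → ℝ) : ℝ :=
  sSup {r : ℝ | ∃ (k : Fin n) (x : Fin n → 𝓧) (y y' : 𝓧), r = partialDiff k y y' f x}

/-- The seminorm `J(f)`, which is `n` times the largest mixed second partial difference, for
bounded `f`. For `n = 1` there are no mixed differences and `J(f) = 0`. -/
def seminormJ {n : ℕ} {𝓧 : Type*} (f : (Fin n → 𝓧) → ℝ) : ℝ :=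
  n * sSup {r : ℝ | ∃ (l k : Fin n) (x : Fin n → 𝓧) (z z' y y' : 𝓧), l ≠ k ∧
    r = partialDiff l z z' (partialDiff k y y' f) x}

/-- `f` has `(a, b)`-weak interactions. (The inequalities force `a, b ≥ 0` when `𝓧` is nonempty,
`n ≥ 1` and `f` is bounded.) -/
def HasWeakInteractions {n : ℕ} {𝓧 : Type*} (a b : ℝ) (f : (Fin n → 𝓧) → ℝ) : Prop :=
  seminormM f ≤ a / n ∧ seminormJ f ≤ b / n

/-- The standard deviation `σ(W)` of a real random variable `W`. -/
def stdDev {Ω : Type*} [MeasurableSpace Ω] (P : Measure Ω) (W : Ω → ℝ) : ℝ :=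
  Real.sqrt (variance W P)

/-- The distance to normality `d_𝒩(W)`: the supremum over all real Lipschitz-1 functions `h` of
`|E[h((W - E[W]) / σ(W))] - E[h(Z)]|`, where `Z` is standard normal. -/
def distNormal {Ω : Type*} [MeasurableSpace Ω] (P : Measure Ω) (W : Ω → ℝ) : ℝ≥0∞ :=
  ⨆ (h : ℝ → ℝ) (_ : LipschitzWith 1 h),
    ENNReal.ofReal |(∫ ω, h ((W ω - ∫ ω', W ω' ∂P) / stdDev P W) ∂P)
      - ∫ z, h z ∂(gaussianReal 0 1)|

end

end WeakInteractions

/-!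
The proof combines Stein's method with the exchange of single coordinates against an independent
copy.

For a test function `h` with `|h'| ≤ 1`, Stein's equation `φ'(x) - x φ(x) = h(x) - E h(Z)` turns
`E h(F) - E h(Z)` into `E[φ'(F) - F φ(F)]`, where `F` is the standardized function. It is solved by
an explicit Gaussian integral, with `|φ|, |φ'| ≤ 1` and `|φ''| ≤ 4` (`exists_stein_solution`).

For `x` and an independent copy `x'`, telescoping `F(x) - F(x')` coordinate by coordinate and
exchanging `x j` with `x' j` expresses the covariance of `g` and `F` as
`½ ∑ⱼ E[Δⱼ g(x) · Δⱼ F(mix j x x')]`, with `mix j x x'` having its first `j` coordinates taken from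
`x'` (`covariance_eq_sum`). A fixed order of the coordinates suffices, no average over subsets of
coordinates being needed. For `g = φ ∘ F` a Taylor expansion gives `E[F φ(F)] ≈ E[φ'(F) T]` with
`T = ½ ∑ⱼ Δⱼ F(x) · Δⱼ F(mix j x x')` (`exchangeSum`) and an error of at most `n M³`, where `M`
bounds the first differences of `F`. Since `E T = 1`, it remains to bound the variance of the mean
`S` of `T` over `x'`. Changing one coordinate of `x` changes `S` by at most `M² + n M B`, where `B`
bounds the mixed second differences of `F` (`abs_exchangeSum_update_sub_le`), and the covariance
identity applied to `S` itself turns this into a variance bound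
(`variance_le_of_bounded_differences`).

Together, `|E h(F) - E h(Z)| ≤ √n (M² + n M B) + n M³`
(`abs_integral_sub_gaussian_le`). Only `|h'| ≤ 1` enters the bound, so it passes to all 1-Lipschitz
functions by smoothing.
-/

namespace WeakInteractions

open MeasureTheory ProbabilityTheory Filter Topology

/-! ### Bounds for Gaussian integrals -/

lemma integrable_abs_gaussianReal : Integrable (fun z : ℝ => |z|) (gaussianReal 0 1) := by
  have := (memLp_id_gaussianReal (μ := 0) (v := 1) 1).integrable (by simp)
  exact this.abs

lemma integral_abs_le_sqrt {α : Type*} [MeasurableSpace α] {μ : Measure α}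
    [IsProbabilityMeasure μ] {Y : α → ℝ} (hY : MemLp Y 2 μ) :
    ∫ x, |Y x| ∂μ ≤ √(∫ x, Y x ^ 2 ∂μ) := by
  apply Real.le_sqrt_of_sq_le
  have h := variance_nonneg (fun x => |Y x|) μ
  rw [variance_eq_sub (by simpa [Real.norm_eq_abs] using hY.norm)] at h
  simp only [Pi.pow_apply, sq_abs] at h
  linarith

lemma integral_abs_gaussianReal_le : ∫ z, |z| ∂(gaussianReal 0 1) ≤ 1 := by
  have hL : MemLp (fun z : ℝ => z) 2 (gaussianReal 0 1) := memLp_id_gaussianReal 2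
  refine (integral_abs_le_sqrt hL).trans ?_
  have h := variance_fun_id_gaussianReal (μ := 0) (v := 1)
  rw [variance_eq_sub hL] at h
  simp only [Pi.pow_apply, integral_id_gaussianReal] at h
  have : ∫ z, z ^ 2 ∂(gaussianReal 0 1) = 1 := by simpa using h
  rw [this]; simp

/-- Gaussian integration by parts: `E[Z g(Z)] = E[g'(Z)]`, because the density `ρ` satisfies
`ρ' = -x ρ`. -/
lemma integral_mul_gaussianReal_eq {g g' : ℝ → ℝ} (hg : ∀ x, HasDerivAt g (g' x) x)
    (hg' : Continuous g') {A B : ℝ} (hA : ∀ x, |g x| ≤ A) (hB : ∀ x, |g' x| ≤ B) :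
    ∫ z, z * g z ∂(gaussianReal 0 1) = ∫ z, g' z ∂(gaussianReal 0 1) := by
  have hgc : Continuous g := continuous_iff_continuousAt.2 fun x => (hg x).continuousAt
  have hpdf : ∀ x, HasDerivAt (gaussianPDFReal 0 1) (-(x * gaussianPDFReal 0 1 x)) x := by
    intro x
    rw [gaussianPDFReal_def]
    have h := ((((hasDerivAt_id x).pow 2).neg.div_const 2).exp).const_mul
      ((√(2 * Real.pi * (1 : NNReal)))⁻¹)
    convert! h using 1
    · ext y; simp
    · simp; ring
  have hint : Integrable (gaussianPDFReal 0 1) := integrable_gaussianPDFReal 0 1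
  have hint' : Integrable (fun x => x * gaussianPDFReal 0 1 x) := by
    have h : Integrable (fun z : ℝ => z) (gaussianReal 0 1) :=
      (memLp_id_gaussianReal (μ := 0) (v := 1) 1).integrable (by simp)
    rw [gaussianReal_of_var_ne_zero _ one_ne_zero,
      integrable_withDensity_iff (measurable_gaussianPDF 0 1) (by simp [gaussianPDF_lt_top])] at h
    simpa [toReal_gaussianPDF] using h
  rw [integral_gaussianReal_eq_integral_smul one_ne_zero,
    integral_gaussianReal_eq_integral_smul one_ne_zero]
  have key := integral_mul_deriv_eq_deriv_mul_of_integrable (u := g)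
    (v := gaussianPDFReal 0 1) (u' := g') (v' := fun x => -(x * gaussianPDFReal 0 1 x))
    (fun x _ => hg x) (fun x _ => hpdf x)
    (hint'.neg.bdd_mul hgc.aestronglyMeasurable (ae_of_all _ hA))
    (hint.bdd_mul hg'.aestronglyMeasurable (ae_of_all _ hB))
    (hint.bdd_mul hgc.aestronglyMeasurable (ae_of_all _ hA))
  have e1 : ∫ x, gaussianPDFReal 0 1 x • (x * g x)
      = -∫ x, g x * -(x * gaussianPDFReal 0 1 x) := by
    rw [← integral_neg]; congr 1; ext x; simp; ring
  rw [e1, key, neg_neg]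
  congr 1; ext x; simp; ring

/-! ### Stein's equation for smooth Lipschitz test functions -/

section Stein

variable {h h1 h2 : ℝ → ℝ}

/-- The solution `φ` of Stein's equation `φ' - x φ = h - E h(Z)` for a test function `h` with
derivative `h1`, in the form `φ(x) = -∫₀^{π/2} cos t · E[h1(x sin t + Z cos t)] dt`. This is the
Ornstein–Uhlenbeck semigroup formula with time `s` reparametrized by `sin t = e⁻ˢ`, which removes
the singularity of the kernel at `s = 0`. -/
noncomputable def steinSol (h1 : ℝ → ℝ) (x : ℝ) : ℝ :=
  -∫ t in (0 : ℝ)..(Real.pi / 2),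
    ∫ z, Real.cos t * h1 (x * Real.sin t + z * Real.cos t) ∂(gaussianReal 0 1)

/-- The derivative of `steinSol`, with the derivative moved from `h1` to the Gaussian density by
integration by parts, so that it is bounded in terms of `h1` alone; see `hasDerivAt_steinSol`. -/
noncomputable def steinDeriv (h1 : ℝ → ℝ) (x : ℝ) : ℝ :=
  -∫ t in (0 : ℝ)..(Real.pi / 2),
    ∫ z, Real.sin t * (z * h1 (x * Real.sin t + z * Real.cos t)) ∂(gaussianReal 0 1)

lemma continuous_cos_mul_inner (hc : Continuous h1) {A : ℝ} (hA : ∀ x, |h1 x| ≤ A) (x : ℝ) :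
    Continuous fun t : ℝ =>
      ∫ z, Real.cos t * h1 (x * Real.sin t + z * Real.cos t) ∂(gaussianReal 0 1) := by
  refine continuous_of_dominated (bound := fun _ => A) (fun t => ?_) (fun t => ae_of_all _ fun z => ?_)
    (integrable_const _) (ae_of_all _ fun z => by fun_prop)
  · exact Continuous.aestronglyMeasurable (by fun_prop)
  · rw [Real.norm_eq_abs, abs_mul]
    calc _ ≤ 1 * |h1 (x * Real.sin t + z * Real.cos t)| := by
          gcongr; exact Real.abs_cos_le_one t
      _ ≤ A := by rw [one_mul]; exact hA _

lemma continuous_sin_mul_inner (hc : Continuous h1) (hA : ∀ x, |h1 x| ≤ 1) (x : ℝ) :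
    Continuous fun t : ℝ =>
      ∫ z, Real.sin t * (z * h1 (x * Real.sin t + z * Real.cos t)) ∂(gaussianReal 0 1) := by
  refine continuous_of_dominated (bound := fun z => |z|) (fun t => ?_)
    (fun t => ae_of_all _ fun z => ?_)
    integrable_abs_gaussianReal (ae_of_all _ fun z => by fun_prop)
  · exact Continuous.aestronglyMeasurable (by fun_prop)
  · rw [Real.norm_eq_abs, abs_mul, abs_mul]
    calc _ ≤ 1 * (|z| * 1) := by
          gcongr
          · exact Real.abs_sin_le_one t
          · exact hA _
      _ = |z| := by ring

lemma abs_steinSol_le (hA : ∀ x, |h1 x| ≤ 1) (x : ℝ) : |steinSol h1 x| ≤ 1 := by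
  rw [steinSol, abs_neg]
  have hpi : (0 : ℝ) ≤ Real.pi / 2 := by positivity
  have h := intervalIntegral.norm_integral_le_of_norm_le (μ := volume) hpi
    (f := fun t => ∫ z, Real.cos t * h1 (x * Real.sin t + z * Real.cos t) ∂(gaussianReal 0 1))
    (g := fun t => Real.cos t) (ae_of_all _ fun t ht => ?_)
    (Real.continuous_cos.intervalIntegrable _ _)
  · simpa using h
  · have hcos : 0 ≤ Real.cos t :=
      Real.cos_nonneg_of_mem_Icc ⟨by linarith [ht.1, Real.pi_pos], ht.2⟩
    refine (norm_integral_le_of_norm_le_const (C := Real.cos t) (ae_of_all _ fun z => ?_)).trans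
      (by simp)
    rw [Real.norm_eq_abs, abs_mul, abs_of_nonneg hcos]
    exact mul_le_of_le_one_right hcos (hA _)

lemma abs_steinDeriv_le (hA : ∀ x, |h1 x| ≤ 1) (x : ℝ) : |steinDeriv h1 x| ≤ 1 := by
  rw [steinDeriv, abs_neg]
  have hpi : (0 : ℝ) ≤ Real.pi / 2 := by positivity
  have h := intervalIntegral.norm_integral_le_of_norm_le (μ := volume) hpi
    (f := fun t => ∫ z, Real.sin t * (z * h1 (x * Real.sin t + z * Real.cos t))
      ∂(gaussianReal 0 1))
    (g := fun t => Real.sin t) (ae_of_all _ fun t ht => ?_)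
    (Real.continuous_sin.intervalIntegrable _ _)
  · simpa using h
  · have hsin : 0 ≤ Real.sin t :=
      Real.sin_nonneg_of_mem_Icc ⟨ht.1.le, by linarith [ht.2, Real.pi_pos]⟩
    refine (norm_integral_le_of_norm_le (g := fun z => Real.sin t * |z|)
      (integrable_abs_gaussianReal.const_mul _) (ae_of_all _ fun z => ?_)).trans ?_
    · rw [Real.norm_eq_abs, abs_mul, abs_of_nonneg hsin, abs_mul]
      exact mul_le_mul_of_nonneg_left (mul_le_of_le_one_right (abs_nonneg z) (hA _)) hsin
    · rw [integral_const_mul]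
      exact mul_le_of_le_one_right hsin integral_abs_gaussianReal_le

lemma abs_sub_le_of_deriv_bound (hh : ∀ x, HasDerivAt h (h1 x) x) (hA : ∀ x, |h1 x| ≤ 1)
    (x y : ℝ) : |h x - h y| ≤ |x - y| := by
  have := Convex.norm_image_sub_le_of_norm_hasDerivWithin_le (s := Set.univ) (C := 1)
    (fun x _ => (hh x).hasDerivWithinAt) (fun x _ => hA x) convex_univ
    (Set.mem_univ y) (Set.mem_univ x)
  simpa using this

/-- Stein's equation. It is the fundamental theorem of calculus for
`t ↦ E[h(x sin t + Z cos t)]` on `[0, π/2]`, which runs from `E[h(Z)]` to `h x`. -/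
lemma steinDeriv_eq (hh : ∀ x, HasDerivAt h (h1 x) x) (hc : Continuous h1)
    (hA : ∀ x, |h1 x| ≤ 1) (x : ℝ) :
    steinDeriv h1 x = x * steinSol h1 x + h x - ∫ z, h z ∂(gaussianReal 0 1) := by
  have hhc : Continuous h := continuous_iff_continuousAt.2 fun x => (hh x).continuousAt
  have hzint : Integrable (fun z : ℝ => |x| + |z|) (gaussianReal 0 1) :=
    (integrable_const _).add integrable_abs_gaussianReal
  have hder : ∀ t : ℝ, HasDerivAt
      (fun t => ∫ z, h (x * Real.sin t + z * Real.cos t) ∂(gaussianReal 0 1))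
      (∫ z, h1 (x * Real.sin t + z * Real.cos t) * (x * Real.cos t + z * -Real.sin t)
        ∂(gaussianReal 0 1)) t := by
    intro t
    refine (hasDerivAt_integral_of_dominated_loc_of_deriv_le (bound := fun z => |x| + |z|)
      (F := fun t z => h (x * Real.sin t + z * Real.cos t))
      (F' := fun t z => h1 (x * Real.sin t + z * Real.cos t) * (x * Real.cos t + z * -Real.sin t))
      univ_mem (Eventually.of_forall fun t => Continuous.aestronglyMeasurable (by fun_prop)) ?_
      (Continuous.aestronglyMeasurable (by fun_prop)) (ae_of_all _ fun z t _ => ?_) hzint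
      (ae_of_all _ fun z t _ => ?_)).2
    · refine Integrable.mono' (g := fun z => |h 0| + (|x| + |z|)) ((integrable_const _).add hzint)
        (Continuous.aestronglyMeasurable (by fun_prop)) (ae_of_all _ fun z => ?_)
      have h3 := abs_sub_le_of_deriv_bound hh hA (x * Real.sin t + z * Real.cos t) 0
      rw [sub_zero] at h3
      have h4 : |x * Real.sin t + z * Real.cos t| ≤ |x| + |z| := by
        refine (abs_add_le _ _).trans ?_
        rw [abs_mul, abs_mul]
        exact add_le_add (mul_le_of_le_one_right (abs_nonneg _) (Real.abs_sin_le_one _))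
          (mul_le_of_le_one_right (abs_nonneg _) (Real.abs_cos_le_one _))
      rw [Real.norm_eq_abs]
      calc |h (x * Real.sin t + z * Real.cos t)|
          = |h 0 + (h (x * Real.sin t + z * Real.cos t) - h 0)| := by ring_nf
        _ ≤ _ := (abs_add_le _ _).trans (by linarith)
    · rw [Real.norm_eq_abs, abs_mul]
      have h4 : |x * Real.cos t + z * -Real.sin t| ≤ |x| + |z| := by
        refine (abs_add_le _ _).trans ?_
        rw [abs_mul, abs_mul, abs_neg]
        exact add_le_add (mul_le_of_le_one_right (abs_nonneg _) (Real.abs_cos_le_one _))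
          (mul_le_of_le_one_right (abs_nonneg _) (Real.abs_sin_le_one _))
      exact (mul_le_of_le_one_left (abs_nonneg _) (hA _)).trans h4
    · exact (hh _).comp t (((Real.hasDerivAt_sin t).const_mul x).add
        ((Real.hasDerivAt_cos t).const_mul z))
  have hcosI : ∀ t, Integrable (fun z => Real.cos t * h1 (x * Real.sin t + z * Real.cos t))
      (gaussianReal 0 1) := fun t =>
    Integrable.of_bound (Continuous.aestronglyMeasurable (by fun_prop)) 1 (ae_of_all _ fun z => by
      rw [Real.norm_eq_abs, abs_mul]
      exact mul_le_one₀ (Real.abs_cos_le_one _) (abs_nonneg _) (hA _))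
  have hsinI : ∀ t, Integrable (fun z => Real.sin t * (z * h1 (x * Real.sin t + z * Real.cos t)))
      (gaussianReal 0 1) := fun t =>
    integrable_abs_gaussianReal.mono' (Continuous.aestronglyMeasurable (by fun_prop))
      (ae_of_all _ fun z => by
        rw [Real.norm_eq_abs, abs_mul, abs_mul]
        exact (mul_le_of_le_one_left (by positivity) (Real.abs_sin_le_one _)).trans
          (mul_le_of_le_one_right (abs_nonneg _) (hA _)))
  have hsplit : ∀ t : ℝ, (∫ z, h1 (x * Real.sin t + z * Real.cos t) *
        (x * Real.cos t + z * -Real.sin t) ∂(gaussianReal 0 1))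
      = x * (∫ z, Real.cos t * h1 (x * Real.sin t + z * Real.cos t) ∂(gaussianReal 0 1))
        - ∫ z, Real.sin t * (z * h1 (x * Real.sin t + z * Real.cos t)) ∂(gaussianReal 0 1) := by
    intro t
    rw [← integral_const_mul, ← integral_sub ((hcosI t).const_mul x) (hsinI t)]
    congr 1; ext z; ring
  have hc1 := continuous_cos_mul_inner hc hA x
  have hc2 := continuous_sin_mul_inner hc hA x
  have hftc := intervalIntegral.integral_eq_sub_of_hasDerivAt (a := 0) (b := Real.pi / 2)
    (fun t _ => hder t) (by
      simp_rw [hsplit]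
      exact ((hc1.const_mul x).sub hc2).intervalIntegrable _ _)
  simp_rw [hsplit] at hftc
  rw [intervalIntegral.integral_sub ((hc1.const_mul x).intervalIntegrable _ _)
    (hc2.intervalIntegrable _ _), intervalIntegral.integral_const_mul] at hftc
  simp only [Real.sin_pi_div_two, Real.cos_pi_div_two, Real.sin_zero, Real.cos_zero, mul_one,
    mul_zero, add_zero, zero_add, integral_const, probReal_univ, one_smul] at hftc
  rw [steinDeriv, steinSol]
  linarith

lemma hasDerivAt_steinSol (hh1 : ∀ x, HasDerivAt h1 (h2 x) x) (hc2 : Continuous h2)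
    (hA : ∀ x, |h1 x| ≤ 1) {B : ℝ} (hB : ∀ x, |h2 x| ≤ B) (x : ℝ) :
    HasDerivAt (steinSol h1) (steinDeriv h1 x) x := by
  have hc : Continuous h1 := continuous_iff_continuousAt.2 fun x => (hh1 x).continuousAt
  have hB0 : 0 ≤ B := (abs_nonneg _).trans (hB 0)
  have hbd : ∀ x t z : ℝ, |Real.cos t * (h2 (x * Real.sin t + z * Real.cos t) * Real.sin t)|
      ≤ B := fun x t z => by
    rw [abs_mul, abs_mul]
    exact (mul_le_of_le_one_left (by positivity) (Real.abs_cos_le_one _)).trans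
      ((mul_le_of_le_one_right (abs_nonneg _) (Real.abs_sin_le_one _)).trans (hB _))
  have hinner : ∀ t y : ℝ, HasDerivAt
      (fun y => ∫ z, Real.cos t * h1 (y * Real.sin t + z * Real.cos t) ∂(gaussianReal 0 1))
      (∫ z, Real.cos t * (h2 (y * Real.sin t + z * Real.cos t) * Real.sin t)
        ∂(gaussianReal 0 1)) y := by
    intro t y
    refine (hasDerivAt_integral_of_dominated_loc_of_deriv_le (bound := fun z => B)
      (F := fun y z => Real.cos t * h1 (y * Real.sin t + z * Real.cos t))
      (F' := fun y z => Real.cos t * (h2 (y * Real.sin t + z * Real.cos t) * Real.sin t))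
      univ_mem (Eventually.of_forall fun t => Continuous.aestronglyMeasurable (by fun_prop)) ?_
      (Continuous.aestronglyMeasurable (by fun_prop)) (ae_of_all _ fun z y _ => hbd y t z)
      (integrable_const _) (ae_of_all _ fun z y _ => ?_)).2
    · exact Integrable.of_bound (Continuous.aestronglyMeasurable (by fun_prop)) 1
        (ae_of_all _ fun z => by
          rw [Real.norm_eq_abs, abs_mul]
          exact mul_le_one₀ (Real.abs_cos_le_one _) (abs_nonneg _) (hA _))
    · refine HasDerivAt.const_mul _ ((hh1 _).comp y ?_)
      simpa using ((hasDerivAt_id y).mul_const (Real.sin t)).add_const (z * Real.cos t)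
  have hparts : ∀ t, (∫ z, Real.cos t * (h2 (x * Real.sin t + z * Real.cos t) * Real.sin t)
        ∂(gaussianReal 0 1))
      = ∫ z, Real.sin t * (z * h1 (x * Real.sin t + z * Real.cos t)) ∂(gaussianReal 0 1) := by
    intro t
    rw [integral_const_mul, integral_mul_const, integral_const_mul,
      integral_mul_gaussianReal_eq (g := fun z => h1 (x * Real.sin t + z * Real.cos t))
        (g' := fun z => h2 (x * Real.sin t + z * Real.cos t) * Real.cos t) (A := 1) (B := B)
        (fun z => (hh1 _).comp z ?_) (by fun_prop) (fun z => hA _) (fun z => ?_),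
      integral_mul_const]
    · ring
    · simpa using ((hasDerivAt_id z).mul_const (Real.cos t)).const_add (x * Real.sin t)
    · rw [abs_mul]
      exact (mul_le_of_le_one_right (abs_nonneg _) (Real.abs_cos_le_one _)).trans (hB _)
  have hmeas : Continuous fun t : ℝ => ∫ z, Real.cos t *
      (h2 (x * Real.sin t + z * Real.cos t) * Real.sin t) ∂(gaussianReal 0 1) :=
    continuous_of_dominated (bound := fun _ => B)
      (fun t => Continuous.aestronglyMeasurable (by fun_prop))
      (fun t => ae_of_all _ fun z => hbd x t z) (integrable_const _)
      (ae_of_all _ fun z => by fun_prop)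
  have houter := (intervalIntegral.hasDerivAt_integral_of_dominated_loc_of_deriv_le
    (μ := volume) (a := 0) (b := Real.pi / 2) (bound := fun _ => B) (x₀ := x)
    (F := fun y t => ∫ z, Real.cos t * h1 (y * Real.sin t + z * Real.cos t) ∂(gaussianReal 0 1))
    (F' := fun y t => ∫ z, Real.cos t * (h2 (y * Real.sin t + z * Real.cos t) * Real.sin t)
      ∂(gaussianReal 0 1))
    univ_mem
    (Eventually.of_forall fun y => (continuous_cos_mul_inner hc hA y).aestronglyMeasurable)
    ((continuous_cos_mul_inner hc hA x).intervalIntegrable _ _)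
    hmeas.aestronglyMeasurable
    (ae_of_all _ fun t _ y _ => (norm_integral_le_of_norm_le_const
      (ae_of_all _ fun z => hbd y t z)).trans (by simp))
    (continuous_const.intervalIntegrable _ _)
    (ae_of_all _ fun t _ y _ => hinner t y)).2
  simp_rw [hparts] at houter
  exact houter.neg

/-- A bounded solution of `ψ' = x ψ + g` with `g ≥ -2` satisfies `ψ ≤ 2 / x` for `x > 0`:
the function `e^{-x²/2} (ψ - 2 / x)` is nondecreasing and, `ψ` being bounded, it stays below a
function tending to `0` at infinity. -/
lemma le_two_of_deriv_eq {ψ g : ℝ → ℝ} (hψ : ∀ x, HasDerivAt ψ (x * ψ x + g x) x)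
    (hbdd : ∀ x, |ψ x| ≤ 1) (hg : ∀ x, -2 ≤ g x) {x : ℝ} (hx : 0 < x) : x * ψ x ≤ 2 := by
  have hexp : ∀ y : ℝ, HasDerivAt (fun y => Real.exp (-(y ^ 2 / 2)))
      (Real.exp (-(y ^ 2 / 2)) * -y) y := fun y => by
    have := (((hasDerivAt_id y).pow 2).div_const 2).neg.exp
    simpa using this
  have hK : ∀ y, 0 < y → HasDerivAt (fun y => Real.exp (-(y ^ 2 / 2)) * (ψ y - 2 * y⁻¹))
      (Real.exp (-(y ^ 2 / 2)) * (g y + 2 + 2 * (y ^ 2)⁻¹)) y := fun y hy => by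
    convert! (hexp y).mul ((hψ y).sub ((hasDerivAt_inv hy.ne').const_mul 2)) using 1
    simp only [Pi.sub_apply]
    field_simp
    ring
  have hmono : MonotoneOn (fun y => Real.exp (-(y ^ 2 / 2)) * (ψ y - 2 * y⁻¹)) (Set.Ici x) := by
    refine monotoneOn_of_hasDerivWithinAt_nonneg (convex_Ici x)
      (fun y hy => (hK y (hx.trans_le hy)).continuousAt.continuousWithinAt)
      (fun y hy => (hK y ?_).hasDerivWithinAt) (fun y hy => ?_)
    · rw [interior_Ici] at hy; exact hx.trans hy
    · have : 0 ≤ g y + 2 := by linarith [hg y]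
      positivity
  have hlim : Tendsto (fun y : ℝ => Real.exp (-(y ^ 2 / 2))) atTop (𝓝 0) := by
    apply Real.tendsto_exp_neg_atTop_nhds_zero.comp
    exact (tendsto_pow_atTop two_ne_zero).atTop_div_const two_pos
  have hle : Real.exp (-(x ^ 2 / 2)) * (ψ x - 2 * x⁻¹) ≤ 0 := by
    refine ge_of_tendsto hlim ?_
    filter_upwards [eventually_ge_atTop x] with y hy
    refine (hmono Set.self_mem_Ici hy hy).trans ?_
    refine mul_le_of_le_one_right (Real.exp_pos _).le ?_
    have : 0 < y := hx.trans_le hy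
    have h1 := (abs_le.1 (hbdd y)).2
    have : 0 ≤ 2 * y⁻¹ := by positivity
    linarith
  have h3 : ψ x - 2 * x⁻¹ ≤ 0 := by
    by_contra hcon
    push Not at hcon
    exact absurd hle (not_le.2 (mul_pos (Real.exp_pos _) hcon))
  have h4 : x * (ψ x - 2 * x⁻¹) ≤ 0 := mul_nonpos_of_nonneg_of_nonpos hx.le h3
  have : x * x⁻¹ = 1 := mul_inv_cancel₀ hx.ne'
  linarith

lemma abs_mul_le_two_of_deriv_eq {ψ g : ℝ → ℝ} (hψ : ∀ x, HasDerivAt ψ (x * ψ x + g x) x)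
    (hbdd : ∀ x, |ψ x| ≤ 1) (hg : ∀ x, |g x| ≤ 2) (x : ℝ) : |x * ψ x| ≤ 2 := by
  have hpos : ∀ {ψ g : ℝ → ℝ} (_ : ∀ x, HasDerivAt ψ (x * ψ x + g x) x)
      (_ : ∀ x, |ψ x| ≤ 1) (_ : ∀ x, |g x| ≤ 2) (x : ℝ), 0 < x → |x * ψ x| ≤ 2 := by
    intro ψ g hψ hbdd hg x hx
    have h1 := le_two_of_deriv_eq hψ hbdd (fun x => (abs_le.1 (hg x)).1) hx
    have h2 := le_two_of_deriv_eq (ψ := fun x => -ψ x) (g := fun x => -g x)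
      (fun x => by convert! (hψ x).neg using 1; ring) (fun x => by simpa using hbdd x)
      (fun x => by linarith [(abs_le.1 (hg x)).2]) hx
    exact abs_le.2 ⟨by linarith, h1⟩
  rcases lt_trichotomy x 0 with hx | rfl | hx
  · have := hpos (ψ := fun x => ψ (-x)) (g := fun x => -g (-x))
      (fun x => by convert! (hψ (-x)).comp x (hasDerivAt_neg x) using 1; ring)
      (fun x => hbdd _) (fun x => by simpa using hg (-x)) (-x) (by linarith)
    simpa using this
  · simp
  · exact hpos hψ hbdd hg x hx

/-- Second order Taylor bound. The hypothesis on `ψ'` makes `±φ + 2 x²` convex, so their graphs lie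
above their tangents. -/
lemma sub_sub_le_of_deriv_le {φ ψ ψ' : ℝ → ℝ} (hφ : ∀ x, HasDerivAt φ (ψ x) x)
    (hψ : ∀ x, HasDerivAt ψ (ψ' x) x) (hb : ∀ x, |ψ' x| ≤ 4) (a b : ℝ) :
    |φ b - φ a - ψ a * (b - a)| ≤ 2 * (b - a) ^ 2 := by
  have hlow : ∀ {φ ψ ψ' : ℝ → ℝ} (_ : ∀ x, HasDerivAt φ (ψ x) x)
      (_ : ∀ x, HasDerivAt ψ (ψ' x) x) (_ : ∀ x, -4 ≤ ψ' x) (a b : ℝ),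
      -(2 * (b - a) ^ 2) ≤ φ b - φ a - ψ a * (b - a) := by
    intro φ ψ ψ' hφ hψ hb a b
    have hd : ∀ x, HasDerivAt (fun x => φ x + 2 * x ^ 2) (ψ x + 4 * x) x := fun x => by
      convert! (hφ x).add (((hasDerivAt_id x).pow 2).const_mul 2) using 1
      simp; ring
    have hconv : ConvexOn ℝ Set.univ (fun x => φ x + 2 * x ^ 2) := by
      refine Monotone.convexOn_univ_of_deriv (fun x => (hd x).differentiableAt) ?_
      rw [show deriv (fun x => φ x + 2 * x ^ 2) = fun x => ψ x + 4 * x from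
        funext fun x => (hd x).deriv]
      refine monotone_of_hasDerivAt_nonneg (f' := fun x => ψ' x + 4)
        (fun x => by convert! (hψ x).add ((hasDerivAt_id x).const_mul 4) using 1; simp)
        fun x => ?_
      simpa using by linarith [hb x]
    rcases lt_trichotomy a b with hab | rfl | hab
    · have h := hconv.le_slope_of_hasDerivAt (Set.mem_univ a) (Set.mem_univ b) hab (hd a)
      rw [slope_def_field, le_div_iff₀ (by linarith)] at h
      nlinarith
    · simp
    · have h := hconv.slope_le_of_hasDerivAt (Set.mem_univ b) (Set.mem_univ a) hab (hd a)
      rw [slope_def_field, div_le_iff₀ (by linarith)] at h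
      nlinarith
  have h1 := hlow hφ hψ (fun x => (abs_le.1 (hb x)).1) a b
  have h2 := hlow (φ := fun x => -φ x) (ψ := fun x => -ψ x) (ψ' := fun x => -ψ' x)
    (fun x => (hφ x).neg) (fun x => (hψ x).neg) (fun x => by linarith [(abs_le.1 (hb x)).2]) a b
  exact abs_le.2 ⟨h1, by linarith⟩

/-- A solution `φ` of Stein's equation with derivative `ψ`, with the bounds needed for the normal
approximation. The last one expresses `|ψ'| ≤ 4`: from `ψ' = x ψ + (φ + h')`, where
`|φ + h'| ≤ 2` and hence `|x ψ| ≤ 2`. The bound `B` on `h''` does not enter the conclusion, which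
makes smoothing of `h` harmless. -/
theorem exists_stein_solution (hh : ∀ x, HasDerivAt h (h1 x) x)
    (hh1 : ∀ x, HasDerivAt h1 (h2 x) x) (hc2 : Continuous h2)
    (hA : ∀ x, |h1 x| ≤ 1) {B : ℝ} (hB : ∀ x, |h2 x| ≤ B) :
    ∃ φ ψ : ℝ → ℝ, Continuous φ ∧ Continuous ψ ∧ (∀ x, |φ x| ≤ 1) ∧ (∀ x, |ψ x| ≤ 1) ∧
      (∀ x, ψ x - x * φ x = h x - ∫ z, h z ∂(gaussianReal 0 1)) ∧
      ∀ x y, |φ y - φ x - ψ x * (y - x)| ≤ 2 * (y - x) ^ 2 := by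
  have hc : Continuous h1 := continuous_iff_continuousAt.2 fun x => (hh1 x).continuousAt
  have hφ := hasDerivAt_steinSol hh1 hc2 hA hB
  have hψ : ∀ x, HasDerivAt (steinDeriv h1)
      (x * steinDeriv h1 x + (steinSol h1 x + h1 x)) x := fun x => by
    have h3 := (((hasDerivAt_id x).mul (hφ x)).add (hh x)).sub_const
      (∫ z, h z ∂(gaussianReal 0 1))
    convert! h3 using 1
    · exact funext fun y => steinDeriv_eq hh hc hA y
    · simp; ring
  have hg : ∀ x, |steinSol h1 x + h1 x| ≤ 2 := fun x =>
    (abs_add_le _ _).trans (by linarith [abs_steinSol_le hA x, hA x])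
  refine ⟨steinSol h1, steinDeriv h1,
    continuous_iff_continuousAt.2 fun x => (hφ x).continuousAt,
    continuous_iff_continuousAt.2 fun x => (hψ x).continuousAt,
    abs_steinSol_le hA, abs_steinDeriv_le hA, fun x => ?_,
    sub_sub_le_of_deriv_le hφ hψ fun x => ?_⟩
  · rw [steinDeriv_eq hh hc hA x]; ring
  · exact (abs_add_le _ _).trans (by
      linarith [abs_mul_le_two_of_deriv_eq hψ (abs_steinDeriv_le hA) hg x, hg x])

end Stein

/-! ### Exchange of coordinates with an independent copy -/

section Exchange

variable {n : ℕ} {𝓧 : Type*}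

/-- The configuration obtained from `x` by replacing its first `k` coordinates by those of `x'`. -/
def mix (k : ℕ) (x x' : Fin n → 𝓧) : Fin n → 𝓧 := fun i => if i.1 < k then x' i else x i

lemma mix_zero (x x' : Fin n → 𝓧) : mix 0 x x' = x := by ext; simp [mix]

lemma mix_self (x x' : Fin n → 𝓧) : mix n x x' = x' := by ext; simp [mix]

lemma mix_succ (j : Fin n) (x x' : Fin n → 𝓧) :
    mix (j + 1) x x' = Function.update (mix j x x') j (x' j) := by
  ext i
  rcases eq_or_ne i j with rfl | hij
  · simp [mix]
  · have : i.1 ≠ j.1 := fun h => hij (Fin.ext h)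
    rw [Function.update_of_ne hij]
    simp only [mix]
    have e : i.1 < j.1 + 1 ↔ i.1 < j.1 := by omega
    simp only [e]

lemma mix_apply_self (j : Fin n) (x x' : Fin n → 𝓧) : mix j x x' j = x j := by simp [mix]

/-- Exchange of the `j`-th coordinates of two configurations. -/
def swapAt (j : Fin n) (z : (Fin n → 𝓧) × (Fin n → 𝓧)) : (Fin n → 𝓧) × (Fin n → 𝓧) :=
  (Function.update z.1 j (z.2 j), Function.update z.2 j (z.1 j))

lemma mix_swapAt (j : Fin n) (z : (Fin n → 𝓧) × (Fin n → 𝓧)) :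
    mix j (swapAt j z).1 (swapAt j z).2 = mix (j + 1) z.1 z.2 := by
  ext i
  rcases eq_or_ne i j with rfl | hij
  · simp [mix, swapAt]
  · have : i.1 ≠ j.1 := fun h => hij (Fin.ext h)
    have e : i.1 < j.1 + 1 ↔ i.1 < j.1 := by omega
    simp only [mix, swapAt, Function.update_of_ne hij, e]

lemma mix_succ_swapAt (j : Fin n) (z : (Fin n → 𝓧) × (Fin n → 𝓧)) :
    mix (j + 1) (swapAt j z).1 (swapAt j z).2 = mix j z.1 z.2 := by
  ext i
  rcases eq_or_ne i j with rfl | hij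
  · simp [mix, swapAt]
  · have : i.1 ≠ j.1 := fun h => hij (Fin.ext h)
    have e : i.1 < j.1 + 1 ↔ i.1 < j.1 := by omega
    simp only [mix, swapAt, Function.update_of_ne hij, e]

lemma mix_update (i j : Fin n) (x x' : Fin n → 𝓧) (y : 𝓧) :
    mix j (Function.update x i y) x' =
      if i.1 < j.1 then mix j x x' else Function.update (mix j x x') i y := by
  split_ifs with h
  · ext l
    rcases eq_or_ne l i with rfl | hl
    · simp [mix, h]
    · simp [mix, Function.update_of_ne hl]
  · ext l
    rcases eq_or_ne l i with rfl | hl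
    · simp [mix, h]
    · simp [mix, Function.update_of_ne hl]

/-- The sum `T(x, x') = ½ ∑ⱼ Δⱼ F(x) · Δⱼ F(mix j x x')`, where `Δⱼ` is the change of `F` when the
`j`-th coordinate is replaced by `x' j`. For `x` and `x'` independent with the same product law,
`E[φ'(F) T]` is the first order approximation of the covariance of `φ ∘ F` and `F`. -/
noncomputable def exchangeSum (F : (Fin n → 𝓧) → ℝ) (x x' : Fin n → 𝓧) : ℝ :=
  1 / 2 * ∑ j : Fin n, (F x - F (Function.update x j (x' j))) *
    (F (mix j x x') - F (mix (j + 1) x x'))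

variable {F : (Fin n → 𝓧) → ℝ} {M B : ℝ}

/-- Changing one coordinate `i` of `x` changes the `j`-th summand of `2 T` by at most `2 M B` if
`j ≠ i`, as each factor changes by a mixed second difference, and by at most `2 M²` if `j = i`. -/
lemma abs_exchangeSum_update_sub_le (hB0 : 0 ≤ B)
    (hM : ∀ k y y' x, |partialDiff k y y' F x| ≤ M)
    (hB : ∀ l k z z' y y' x, l ≠ k → |partialDiff l z z' (partialDiff k y y' F) x| ≤ B)
    (x x' : Fin n → 𝓧) (i : Fin n) (y : 𝓧) :
    |exchangeSum F (Function.update x i y) x' - exchangeSum F x x'| ≤ M ^ 2 + n * (M * B) := by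
  have hM0 : 0 ≤ M := (abs_nonneg _).trans (hM i y y x)
  have hD : ∀ (j : Fin n) (u : Fin n → 𝓧),
      F u - F (Function.update u j (x' j)) = partialDiff j (u j) (x' j) F u := fun j u => by
    simp [partialDiff]
  have hd : ∀ (j : Fin n) (u : Fin n → 𝓧), F (mix j u x') - F (mix (j + 1) u x')
      = partialDiff j (u j) (x' j) F (mix j u x') := fun j u => by
    rw [mix_succ, hD, mix_apply_self]
  simp only [exchangeSum, hD, hd]
  rw [← mul_sub, ← Finset.sum_sub_distrib, abs_mul]
  have hprod : ∀ u v u' v' e : ℝ, |u| ≤ M → |v'| ≤ M → |u' - u| ≤ e → |v' - v| ≤ e →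
      |u' * v' - u * v| ≤ 2 * (M * e) := by
    intro u v u' v' e hu hv' h1 h2
    calc |u' * v' - u * v| = |(u' - u) * v' + u * (v' - v)| := by ring_nf
      _ ≤ |u' - u| * |v'| + |u| * |v' - v| := by
        rw [← abs_mul, ← abs_mul]; exact abs_add_le _ _
      _ ≤ e * M + M * e := by
        gcongr
        exact (abs_nonneg _).trans h1
      _ = 2 * (M * e) := by ring
  have hterm : ∀ j : Fin n,
      |partialDiff j (Function.update x i y j) (x' j) F (Function.update x i y) *
          partialDiff j (Function.update x i y j) (x' j) F (mix j (Function.update x i y) x')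
        - partialDiff j (x j) (x' j) F x * partialDiff j (x j) (x' j) F (mix j x x')|
      ≤ (if j = i then 2 * M ^ 2 else 0) + 2 * (M * B) := by
    intro j
    by_cases hji : j = i
    · rw [if_pos hji]
      have h0 : 0 ≤ 2 * (M * B) := by positivity
      refine le_trans ?_ (le_add_of_nonneg_right h0)
      refine (abs_sub _ _).trans ?_
      rw [abs_mul, abs_mul, two_mul, sq]
      exact add_le_add (mul_le_mul (hM _ _ _ _) (hM _ _ _ _) (abs_nonneg _) hM0)
        (mul_le_mul (hM _ _ _ _) (hM _ _ _ _) (abs_nonneg _) hM0)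
    · rw [if_neg hji, zero_add, Function.update_of_ne hji]
      refine hprod _ _ _ _ B (hM _ _ _ _) (hM _ _ _ _) ?_ ?_
      · have := hB i j y (x i) (x j) (x' j) x (Ne.symm hji)
        rw [partialDiff, Function.update_eq_self] at this
        exact this
      · rw [mix_update]
        split_ifs with hlt
        · simpa using hB0
        · have := hB i j y (mix j x x' i) (x j) (x' j) (mix j x x') (Ne.symm hji)
          rw [partialDiff, Function.update_eq_self] at this
          exact this
  calc |(1 / 2 : ℝ)| * _
      ≤ |(1 / 2 : ℝ)| * ∑ j : Fin n, ((if j = i then 2 * M ^ 2 else 0) + 2 * (M * B)) := by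
        gcongr
        exact (Finset.abs_sum_le_sum_abs _ _).trans (Finset.sum_le_sum fun j _ => hterm j)
    _ = M ^ 2 + n * (M * B) := by
        rw [Finset.sum_add_distrib, Finset.sum_ite_eq']
        simp only [Finset.mem_univ, if_true, Finset.sum_const, Finset.card_univ, Fintype.card_fin,
          nsmul_eq_mul, abs_of_pos (show (0 : ℝ) < 1 / 2 by norm_num)]
        ring

variable [MeasurableSpace 𝓧]

lemma measurable_mix (k : ℕ) :
    Measurable fun z : (Fin n → 𝓧) × (Fin n → 𝓧) => mix k z.1 z.2 := by
  refine measurable_pi_iff.2 fun i => ?_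
  unfold mix
  split_ifs <;> fun_prop

lemma measurable_update_fst (j : Fin n) :
    Measurable fun z : (Fin n → 𝓧) × (Fin n → 𝓧) => Function.update z.1 j (z.2 j) := by
  refine measurable_pi_iff.2 fun i => ?_
  rcases eq_or_ne i j with rfl | hij
  · simp only [Function.update_self]; fun_prop
  · simp only [Function.update_of_ne hij]; fun_prop

variable (μ : Fin n → Measure 𝓧) [∀ i, IsProbabilityMeasure (μ i)]

lemma measurePreserving_swapAt (j : Fin n) :
    MeasurePreserving (swapAt j) ((Measure.pi μ).prod (Measure.pi μ))
      ((Measure.pi μ).prod (Measure.pi μ)) := by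
  have he := measurePreserving_arrowProdEquivProdArrow 𝓧 𝓧 (Fin n) μ μ
  have hs : MeasurePreserving
      (fun (w : Fin n → 𝓧 × 𝓧) i => if i = j then (w i).swap else w i)
      (Measure.pi fun i => (μ i).prod (μ i)) (Measure.pi fun i => (μ i).prod (μ i)) := by
    refine measurePreserving_pi (fun i => (μ i).prod (μ i)) (fun i => (μ i).prod (μ i))
      (f := fun i p => if i = j then p.swap else p) fun i => ?_
    by_cases h : i = j
    · simp only [h, if_true]; exact Measure.measurePreserving_swap
    · simp only [h, if_false]; exact MeasurePreserving.id _
  have h := (he.comp hs).comp (he.symm _)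
  convert! h using 1
  ext z i
  · rcases eq_or_ne i j with rfl | hij
    · simp [swapAt, MeasurableEquiv.arrowProdEquivProdArrow, Equiv.arrowProdEquivProdArrow]
    · simp [swapAt, MeasurableEquiv.arrowProdEquivProdArrow, Equiv.arrowProdEquivProdArrow, hij]
  · rcases eq_or_ne i j with rfl | hij
    · simp [swapAt, MeasurableEquiv.arrowProdEquivProdArrow, Equiv.arrowProdEquivProdArrow]
    · simp [swapAt, MeasurableEquiv.arrowProdEquivProdArrow, Equiv.arrowProdEquivProdArrow, hij]

lemma integrable_of_abs_le {α : Type*} [MeasurableSpace α] {ρ : Measure α} [IsFiniteMeasure ρ]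
    {g : α → ℝ} (hg : Measurable g) {A : ℝ} (hA : ∀ x, |g x| ≤ A) : Integrable g ρ :=
  Integrable.of_bound hg.aestronglyMeasurable A (ae_of_all _ hA)

lemma abs_integral_le_of_abs_le {α : Type*} [MeasurableSpace α] {ρ : Measure α}
    [IsProbabilityMeasure ρ] {g : α → ℝ} {A : ℝ} (hA : ∀ x, |g x| ≤ A) : |∫ x, g x ∂ρ| ≤ A := by
  simpa using norm_integral_le_of_norm_le_const (μ := ρ) (f := g) (C := A) (ae_of_all ρ hA)

/-- Covariance identity for functions of independent variables. Telescope `f(x) - f(x')` along the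
configurations `mix j x x'`; exchanging `x j` with `x' j` preserves the product law, changes the
sign of the `j`-th increment of `f`, and turns `g(x)` into `g` of the updated configuration. -/
lemma covariance_eq_sum {f g : (Fin n → 𝓧) → ℝ} (hf : IsBoundedMeasurable f)
    (hg : IsBoundedMeasurable g) :
    ∫ x, g x * f x ∂(Measure.pi μ) - (∫ x, g x ∂(Measure.pi μ)) * ∫ x, f x ∂(Measure.pi μ) =
      1 / 2 * ∑ j : Fin n, ∫ z, (g z.1 - g (Function.update z.1 j (z.2 j))) *
        (f (mix j z.1 z.2) - f (mix (j + 1) z.1 z.2)) ∂((Measure.pi μ).prod (Measure.pi μ)) := by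
  obtain ⟨hfm, A, hA⟩ := hf
  obtain ⟨hgm, A', hA'⟩ := hg
  set ν := Measure.pi μ with hν
  have hd : ∀ k : ℕ, Measurable fun z : (Fin n → 𝓧) × (Fin n → 𝓧) => f (mix k z.1 z.2) :=
    fun k => hfm.comp (measurable_mix k)
  have hgu : ∀ j : Fin n, Measurable
      fun z : (Fin n → 𝓧) × (Fin n → 𝓧) => g (Function.update z.1 j (z.2 j)) :=
    fun j => hgm.comp (measurable_update_fst j)
  have hg1 : Measurable fun z : (Fin n → 𝓧) × (Fin n → 𝓧) => g z.1 := hgm.comp measurable_fst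
  have hbd : ∀ (u v w : Fin n → 𝓧), |g u * (f v - f w)| ≤ A' * (A + A) := fun u v w => by
    rw [abs_mul]
    have h1 : |f v - f w| ≤ A + A := (abs_sub _ _).trans (add_le_add (hA v) (hA w))
    exact mul_le_mul (hA' u) h1 (abs_nonneg _) ((abs_nonneg _).trans (hA' u))
  have hint1 : ∀ j : Fin n, Integrable (fun z : (Fin n → 𝓧) × (Fin n → 𝓧) =>
      g z.1 * (f (mix j z.1 z.2) - f (mix (j + 1) z.1 z.2))) (ν.prod ν) := fun j =>
    integrable_of_abs_le (hg1.mul ((hd j).sub (hd (j + 1)))) fun z => hbd _ _ _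
  have hint2 : ∀ j : Fin n, Integrable (fun z : (Fin n → 𝓧) × (Fin n → 𝓧) =>
      g (Function.update z.1 j (z.2 j)) * (f (mix j z.1 z.2) - f (mix (j + 1) z.1 z.2)))
      (ν.prod ν) := fun j =>
    integrable_of_abs_le ((hgu j).mul ((hd j).sub (hd (j + 1)))) fun z => hbd _ _ _
  have hswap : ∀ j : Fin n, ∫ z, g (Function.update z.1 j (z.2 j)) *
      (f (mix j z.1 z.2) - f (mix (j + 1) z.1 z.2)) ∂(ν.prod ν)
      = -∫ z, g z.1 * (f (mix j z.1 z.2) - f (mix (j + 1) z.1 z.2)) ∂(ν.prod ν) := by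
    intro j
    have hmp := measurePreserving_swapAt μ j
    rw [← hν] at hmp
    have hm : Measurable fun z : (Fin n → 𝓧) × (Fin n → 𝓧) =>
        g z.1 * (f (mix j z.1 z.2) - f (mix (j + 1) z.1 z.2)) :=
      hg1.mul ((hd j).sub (hd (j + 1)))
    conv_rhs => rw [← hmp.map_eq]
    rw [integral_map hmp.measurable.aemeasurable hm.aestronglyMeasurable, ← integral_neg]
    refine integral_congr_ae (ae_of_all _ fun z => ?_)
    simp only [mix_swapAt, mix_succ_swapAt]
    simp only [swapAt]
    ring
  have hterm : ∀ j : Fin n, ∫ z, (g z.1 - g (Function.update z.1 j (z.2 j))) *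
        (f (mix j z.1 z.2) - f (mix (j + 1) z.1 z.2)) ∂(ν.prod ν)
      = 2 * ∫ z, g z.1 * (f (mix j z.1 z.2) - f (mix (j + 1) z.1 z.2)) ∂(ν.prod ν) := by
    intro j
    simp_rw [sub_mul]
    rw [integral_sub (hint1 j) (hint2 j), hswap j]
    ring
  simp_rw [hterm]
  rw [← Finset.mul_sum, ← integral_finsetSum _ (fun j _ => hint1 j)]
  have htel : ∀ z : (Fin n → 𝓧) × (Fin n → 𝓧),
      ∑ j : Fin n, g z.1 * (f (mix j z.1 z.2) - f (mix (j + 1) z.1 z.2))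
        = g z.1 * f z.1 - g z.1 * f z.2 := by
    intro z
    rw [← Finset.mul_sum, Fin.sum_univ_eq_sum_range
      (fun j => f (mix j z.1 z.2) - f (mix (j + 1) z.1 z.2)) n, Finset.sum_range_sub'
      (fun j => f (mix j z.1 z.2)), mix_zero, mix_self, mul_sub]
  simp_rw [htel]
  have hb2 : ∀ u v, |g u * f v| ≤ A' * A := fun u v => by
    rw [abs_mul]
    exact mul_le_mul (hA' u) (hA v) (abs_nonneg _) ((abs_nonneg _).trans (hA' u))
  have hi1 : Integrable (fun z : (Fin n → 𝓧) × (Fin n → 𝓧) => g z.1 * f z.1) (ν.prod ν) :=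
    integrable_of_abs_le (hg1.mul (hfm.comp measurable_fst)) fun z => hb2 _ _
  have hi2 : Integrable (fun z : (Fin n → 𝓧) × (Fin n → 𝓧) => g z.1 * f z.2) (ν.prod ν) :=
    integrable_of_abs_le (hg1.mul (hfm.comp measurable_snd)) fun z => hb2 _ _
  rw [integral_sub hi1 hi2, integral_prod_mul, integral_fun_fst (fun x => g x * f x)]
  simp

/-- Variance bound for functions with bounded differences, from the covariance identity with
`f = g = G`. -/
lemma variance_le_of_bounded_differences {G : (Fin n → 𝓧) → ℝ} (hG : IsBoundedMeasurable G)
    {c : ℝ} (hc : ∀ x i y, |G (Function.update x i y) - G x| ≤ c) :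
    ∫ x, G x ^ 2 ∂(Measure.pi μ) - (∫ x, G x ∂(Measure.pi μ)) ^ 2 ≤ n * c ^ 2 := by
  have h := covariance_eq_sum μ hG hG
  simp only [← pow_two] at h
  rw [h]
  have hj : ∀ j : Fin n, ∫ z, (G z.1 - G (Function.update z.1 j (z.2 j))) *
        (G (mix j z.1 z.2) - G (mix (j + 1) z.1 z.2)) ∂((Measure.pi μ).prod (Measure.pi μ))
        ≤ c ^ 2 := fun j => by
    refine (le_abs_self _).trans (abs_integral_le_of_abs_le fun z => ?_)
    rw [abs_mul, sq, mix_succ, abs_sub_comm (G z.1),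
      abs_sub_comm (G (mix j z.1 z.2))]
    exact mul_le_mul (hc _ _ _) (hc _ _ _) (abs_nonneg _) ((abs_nonneg _).trans (hc z.1 j (z.2 j)))
  calc _ ≤ 1 / 2 * ∑ j : Fin n, c ^ 2 := by gcongr with j; exact hj j
    _ ≤ n * c ^ 2 := by
      simp only [Finset.sum_const, Finset.card_univ, Fintype.card_fin, nsmul_eq_mul]
      have : 0 ≤ n * c ^ 2 := by positivity
      linarith

/-- Normal approximation for smooth test functions. With `φ` the Stein solution, `φ' = ψ`, `T` the
exchange sum and `S` its mean over the independent copy, `E h(F) - E h(Z)` equals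
`E[ψ(F) (1 - S)]`, bounded through the variance of `S`, minus `E[φ(F) F] - E[ψ(F) S]`, which is the
Taylor remainder in the covariance identity. -/
theorem abs_integral_sub_gaussian_le (hF : IsBoundedMeasurable F)
    (hmean : ∫ x, F x ∂(Measure.pi μ) = 0) (hvar : ∫ x, F x ^ 2 ∂(Measure.pi μ) = 1)
    (hM : ∀ k y y' x, |partialDiff k y y' F x| ≤ M) (hB0 : 0 ≤ B)
    (hB : ∀ l k z z' y y' x, l ≠ k → |partialDiff l z z' (partialDiff k y y' F) x| ≤ B)
    (hn : 1 ≤ n)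
    {h h1 h2 : ℝ → ℝ} (hh : ∀ x, HasDerivAt h (h1 x) x)
    (hh1 : ∀ x, HasDerivAt h1 (h2 x) x) (hc2 : Continuous h2)
    (hA : ∀ x, |h1 x| ≤ 1) {K : ℝ} (hK : ∀ x, |h2 x| ≤ K) :
    |∫ x, h (F x) ∂(Measure.pi μ) - ∫ z, h z ∂(gaussianReal 0 1)| ≤
      √n * (M ^ 2 + n * (M * B)) + n * M ^ 3 := by
  obtain ⟨φ, ψ, hφc, hψc, hφ1, hψ1, heq, htaylor⟩ := exists_stein_solution hh hh1 hc2 hA hK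
  obtain ⟨hFm, A, hFA⟩ := id hF
  set ν := Measure.pi μ with hν
  have hne : Nonempty (Fin n → 𝓧) := by
    by_contra hcon
    rw [not_nonempty_iff] at hcon
    have := measure_univ (μ := ν)
    rw [Set.univ_eq_empty_iff.2 hcon, measure_empty] at this
    exact zero_ne_one this
  obtain ⟨x₀⟩ := hne
  have hM0 : 0 ≤ M := (abs_nonneg _).trans (hM ⟨0, hn⟩ (x₀ ⟨0, hn⟩) (x₀ ⟨0, hn⟩) x₀)
  set c := M ^ 2 + n * (M * B) with hc
  have hc0 : 0 ≤ c := by positivity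
  -- `D j` and `d j` are the increments in coordinate `j`, at `z.1` and at `mix j z.1 z.2`
  set D : Fin n → (Fin n → 𝓧) × (Fin n → 𝓧) → ℝ :=
    fun j z => F z.1 - F (Function.update z.1 j (z.2 j)) with hDdef
  set d : Fin n → (Fin n → 𝓧) × (Fin n → 𝓧) → ℝ :=
    fun j z => F (mix j z.1 z.2) - F (mix (j + 1) z.1 z.2) with hddef
  have hDm : ∀ j, Measurable (D j) := fun j =>
    (hFm.comp measurable_fst).sub (hFm.comp (measurable_update_fst j))
  have hdm : ∀ j, Measurable (d j) := fun j =>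
    (hFm.comp (measurable_mix j)).sub (hFm.comp (measurable_mix (j + 1)))
  have hDb : ∀ j z, |D j z| ≤ M := fun j z => by
    have := hM j (z.1 j) (z.2 j) z.1
    rwa [partialDiff, Function.update_eq_self] at this
  have hdb : ∀ j z, |d j z| ≤ M := fun j z => by
    have := hM j (mix j z.1 z.2 j) (z.2 j) (mix j z.1 z.2)
    rwa [partialDiff, Function.update_eq_self, ← mix_succ] at this
  set T : (Fin n → 𝓧) × (Fin n → 𝓧) → ℝ := fun z => exchangeSum F z.1 z.2 with hT
  have hTeq : ∀ z, T z = 1 / 2 * ∑ j, D j z * d j z := fun z => rfl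
  have hTm : Measurable T :=
    (Finset.measurable_sum _ fun j _ => (hDm j).mul (hdm j)).const_mul _
  have hTb : ∀ z, |T z| ≤ n * M ^ 2 := fun z => by
    rw [hTeq, abs_mul]
    have h1 : |∑ j, D j z * d j z| ≤ ∑ _j : Fin n, M ^ 2 :=
      (Finset.abs_sum_le_sum_abs _ _).trans (Finset.sum_le_sum fun j _ => by
        rw [abs_mul, sq]; exact mul_le_mul (hDb j z) (hdb j z) (abs_nonneg _) hM0)
    rw [Finset.sum_const, Finset.card_univ, Fintype.card_fin, nsmul_eq_mul] at h1
    rw [abs_of_pos (show (0 : ℝ) < 1 / 2 by norm_num)]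
    have := abs_nonneg (∑ j, D j z * d j z)
    linarith
  have hTint : Integrable T (ν.prod ν) := integrable_of_abs_le hTm hTb
  set S : (Fin n → 𝓧) → ℝ := fun x => ∫ x', T (x, x') ∂ν with hS
  have hSm : Measurable S := (hTm.stronglyMeasurable.integral_prod_right').measurable
  have hSb : ∀ x, |S x| ≤ n * M ^ 2 := fun x =>
    abs_integral_le_of_abs_le fun x' => hTb (x, x')
  have hTx : ∀ x, Integrable (fun x' => T (x, x')) ν := fun x =>
    integrable_of_abs_le (hTm.comp measurable_prodMk_left) fun x' => hTb _
  -- `E S = E T` is the variance of `F`, by the covariance identity applied to `F` and `F`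
  have hSmean : ∫ x, S x ∂ν = 1 := by
    have h := covariance_eq_sum μ hF hF
    rw [← hν, hmean] at h
    simp only [← pow_two] at h
    rw [hvar] at h
    rw [hS, ← integral_prod T hTint]
    simp_rw [hTeq]
    rw [integral_const_mul, integral_finsetSum _ fun j _ => ?_]
    · rw [← h]; simp
    · exact integrable_of_abs_le ((hDm j).mul (hdm j)) (A := M * M) fun z => by
        rw [abs_mul]; exact mul_le_mul (hDb j z) (hdb j z) (abs_nonneg _) hM0
  have hSdiff : ∀ x i y, |S (Function.update x i y) - S x| ≤ c := fun x i y => by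
    rw [hS]
    simp only
    rw [← integral_sub (hTx _) (hTx _)]
    exact abs_integral_le_of_abs_le fun x' => abs_exchangeSum_update_sub_le hB0 hM hB x x' i y
  have hSvar : ∫ x, (S x - 1) ^ 2 ∂ν ≤ n * c ^ 2 := by
    have h := variance_le_of_bounded_differences μ (G := S) ⟨hSm, _, hSb⟩ hSdiff
    rw [← hν, hSmean] at h
    have hS2 : Integrable (fun x => S x ^ 2) ν :=
      integrable_of_abs_le (hSm.pow_const 2) (A := (n * M ^ 2) ^ 2) fun x => by
        rw [abs_pow]; exact pow_le_pow_left₀ (abs_nonneg _) (hSb x) 2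
    have hS1 : Integrable S ν := integrable_of_abs_le hSm hSb
    have e : ∫ x, (S x - 1) ^ 2 ∂ν = ∫ x, (S x ^ 2 - 2 * S x + 1) ∂ν := by
      congr 1; ext x; ring
    have hS3 : Integrable (fun x => S x ^ 2 - 2 * S x) ν := hS2.sub (hS1.const_mul 2)
    rw [e, integral_add hS3 (integrable_const _),
      integral_sub hS2 (hS1.const_mul 2), integral_const_mul, hSmean]
    simp
    linarith
  have hSabs : ∫ x, |S x - 1| ∂ν ≤ √n * c := by
    have hL : MemLp (fun x => S x - 1) 2 ν :=
      MemLp.of_bound (hSm.sub_const 1).aestronglyMeasurable (n * M ^ 2 + 1)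
        (ae_of_all _ fun x => (abs_sub _ _).trans (by simpa using hSb x))
    refine (integral_abs_le_sqrt hL).trans ?_
    calc √(∫ x, (S x - 1) ^ 2 ∂ν) ≤ √(n * c ^ 2) := Real.sqrt_le_sqrt hSvar
      _ = √n * c := by rw [Real.sqrt_mul (by positivity), Real.sqrt_sq hc0]
  have hψFm : Measurable fun x => ψ (F x) := hψc.measurable.comp hFm
  have hφFm : Measurable fun x => φ (F x) := hφc.measurable.comp hFm
  have hcov := covariance_eq_sum μ hF (g := fun x => φ (F x)) ⟨hφFm, 1, fun x => hφ1 _⟩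
  rw [← hν, hmean, mul_zero, sub_zero] at hcov
  have hψT : ∫ x, ψ (F x) * S x ∂ν
      = 1 / 2 * ∑ j, ∫ z, ψ (F z.1) * D j z * d j z ∂(ν.prod ν) := by
    have hint : ∀ j, Integrable (fun z => ψ (F z.1) * D j z * d j z) (ν.prod ν) := fun j =>
      integrable_of_abs_le (((hψFm.comp measurable_fst).mul (hDm j)).mul (hdm j))
        (A := 1 * M * M) fun z => by
          rw [abs_mul, abs_mul]
          exact mul_le_mul (mul_le_mul (hψ1 _) (hDb j z) (abs_nonneg _) zero_le_one) (hdb j z)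
            (abs_nonneg _) (by positivity)
    have hintT : Integrable (fun z : (Fin n → 𝓧) × (Fin n → 𝓧) => ψ (F z.1) * T z) (ν.prod ν) :=
      hTint.bdd_mul (hψFm.comp measurable_fst).aestronglyMeasurable (ae_of_all _ fun z => hψ1 _)
    rw [← integral_finsetSum _ fun j _ => hint j, ← integral_const_mul]
    have e : ∀ x, ψ (F x) * S x = ∫ x', ψ (F x) * T (x, x') ∂ν := fun x =>
      (integral_const_mul _ _).symm
    simp_rw [e]
    rw [← integral_prod (fun z => ψ (F z.1) * T z) hintT]
    congr 1; ext z
    rw [hTeq, Finset.mul_sum, Finset.mul_sum, Finset.mul_sum]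
    exact Finset.sum_congr rfl fun j _ => by ring
  have hrem : |∫ x, φ (F x) * F x ∂ν - ∫ x, ψ (F x) * S x ∂ν| ≤ n * M ^ 3 := by
    rw [hcov, hψT, ← mul_sub, ← Finset.sum_sub_distrib, abs_mul]
    have hj : ∀ j : Fin n, |∫ z, (φ (F z.1) - φ (F (Function.update z.1 j (z.2 j)))) *
        (F (mix j z.1 z.2) - F (mix (j + 1) z.1 z.2)) ∂(ν.prod ν)
        - ∫ z, ψ (F z.1) * D j z * d j z ∂(ν.prod ν)| ≤ 2 * M ^ 3 := by
      intro j
      rw [← integral_sub]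
      · refine abs_integral_le_of_abs_le fun z => ?_
        have e : (φ (F z.1) - φ (F (Function.update z.1 j (z.2 j)))) *
            (F (mix j z.1 z.2) - F (mix (j + 1) z.1 z.2)) - ψ (F z.1) * D j z * d j z
            = -(φ (F (Function.update z.1 j (z.2 j))) - φ (F z.1)
              - ψ (F z.1) * (F (Function.update z.1 j (z.2 j)) - F z.1)) * d j z := by
          simp only [hDdef, hddef]; ring
        rw [e, abs_mul, abs_neg]
        have h3 := htaylor (F z.1) (F (Function.update z.1 j (z.2 j)))
        have h4 : (F (Function.update z.1 j (z.2 j)) - F z.1) ^ 2 ≤ M ^ 2 := by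
          rw [← sq_abs, abs_sub_comm]
          exact pow_le_pow_left₀ (abs_nonneg _) (hDb j z) 2
        calc _ ≤ (2 * M ^ 2) * M :=
              mul_le_mul (h3.trans (by linarith)) (hdb j z) (abs_nonneg _) (by positivity)
          _ = 2 * M ^ 3 := by ring
      · refine integrable_of_abs_le (((hφFm.comp measurable_fst).sub
          (hφFm.comp (measurable_update_fst j))).mul (hdm j)) (A := 2 * M) fun z => ?_
        rw [abs_mul]
        refine mul_le_mul ((abs_sub _ _).trans ?_) (hdb j z) (abs_nonneg _) (by norm_num)
        linarith [hφ1 (F z.1), hφ1 (F (Function.update z.1 j (z.2 j)))]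
      · refine integrable_of_abs_le (((hψFm.comp measurable_fst).mul (hDm j)).mul (hdm j))
          (A := 1 * M * M) fun z => ?_
        rw [abs_mul, abs_mul]
        exact mul_le_mul (mul_le_mul (hψ1 _) (hDb j z) (abs_nonneg _) zero_le_one) (hdb j z)
          (abs_nonneg _) (by positivity)
    calc _ ≤ |(1 / 2 : ℝ)| * ∑ _j : Fin n, 2 * M ^ 3 := by
          gcongr
          exact (Finset.abs_sum_le_sum_abs _ _).trans (Finset.sum_le_sum fun j _ => hj j)
      _ = n * M ^ 3 := by
          rw [Finset.sum_const, Finset.card_univ, Fintype.card_fin, nsmul_eq_mul,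
            abs_of_pos (show (0 : ℝ) < 1 / 2 by norm_num)]
          ring
  have hψint : Integrable (fun x => ψ (F x)) ν := integrable_of_abs_le hψFm fun x => hψ1 _
  have hφFint : Integrable (fun x => φ (F x) * F x) ν :=
    (integrable_of_abs_le hFm hFA).bdd_mul hφFm.aestronglyMeasurable (ae_of_all _ fun z => hφ1 _)
  have hψSint : Integrable (fun x => ψ (F x) * S x) ν :=
    (integrable_of_abs_le hSm hSb).bdd_mul hψFm.aestronglyMeasurable (ae_of_all _ fun z => hψ1 _)
  have hmain : ∫ x, h (F x) ∂ν - ∫ z, h z ∂(gaussianReal 0 1)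
      = -(∫ x, ψ (F x) * (S x - 1) ∂ν)
        - (∫ x, φ (F x) * F x ∂ν - ∫ x, ψ (F x) * S x ∂ν) := by
    have e1 : ∀ x, h (F x) = ψ (F x) - φ (F x) * F x + ∫ z, h z ∂(gaussianReal 0 1) := fun x => by
      have := heq (F x); linarith [mul_comm (F x) (φ (F x))]
    have hdiff : Integrable (fun x => ψ (F x) - φ (F x) * F x) ν := hψint.sub hφFint
    simp_rw [e1, mul_sub, mul_one]
    rw [integral_add hdiff (integrable_const _), integral_sub hψint hφFint,
      integral_sub hψSint hψint]
    simp
  have hfirst : |∫ x, ψ (F x) * (S x - 1) ∂ν| ≤ √n * c := by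
    refine (norm_integral_le_of_norm_le (f := fun x => ψ (F x) * (S x - 1))
      (g := fun x => |S x - 1|) (((integrable_of_abs_le hSm hSb).sub (integrable_const 1)).abs)
      (ae_of_all _ fun x => ?_)).trans hSabs
    rw [Real.norm_eq_abs, abs_mul]
    exact mul_le_of_le_one_left (abs_nonneg _) (hψ1 _)
  rw [hmain]
  refine (abs_sub _ _).trans ?_
  rw [abs_neg]
  exact add_le_add hfirst hrem

end Exchange

/-! ### Smoothing of Lipschitz test functions -/

/-- The average of `h` over the window `[x, x + ε]`. -/
noncomputable def slidingAverage (ε : ℝ) (h : ℝ → ℝ) (x : ℝ) : ℝ := (∫ t in x..(x + ε), h t) / ε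

lemma hasDerivAt_slidingAverage {h : ℝ → ℝ} (hc : Continuous h) (ε x : ℝ) :
    HasDerivAt (slidingAverage ε h) ((h (x + ε) - h x) / ε) x := by
  have hF : ∀ y, HasDerivAt (fun y => ∫ t in (0 : ℝ)..y, h t) (h y) y := fun y =>
    (hc.integral_hasStrictDerivAt 0 y).hasDerivAt
  have h1 := (((hF (x + ε)).comp_add_const x ε).sub (hF x)).div_const ε
  convert! h1 using 1
  ext y
  simp only [slidingAverage, Pi.sub_apply]
  rw [intervalIntegral.integral_interval_sub_left (hc.intervalIntegrable _ _)
    (hc.intervalIntegrable _ _)]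

lemma abs_slidingAverage_sub_le {h : ℝ → ℝ} (hc : Continuous h)
    (hl : ∀ x y, |h x - h y| ≤ |x - y|) {ε : ℝ} (hε : 0 < ε) (x : ℝ) :
    |slidingAverage ε h x - h x| ≤ ε := by
  have e : slidingAverage ε h x - h x = (∫ t in x..(x + ε), (h t - h x)) / ε := by
    rw [intervalIntegral.integral_sub (hc.intervalIntegrable _ _)
      (continuous_const.intervalIntegrable _ _), intervalIntegral.integral_const, slidingAverage]
    simp only [add_sub_cancel_left, smul_eq_mul]
    field_simp
  have h1 := intervalIntegral.norm_integral_le_of_norm_le_const (a := x) (b := x + ε) (C := ε)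
    (f := fun t => h t - h x) fun t ht => by
      rw [Set.uIoc_of_le (by linarith)] at ht
      refine (hl t x).trans ?_
      rw [abs_of_nonneg (by linarith [ht.1])]
      linarith [ht.2]
  rw [e, abs_div, abs_of_pos hε, div_le_iff₀ hε]
  simpa [abs_of_pos hε] using h1

/-- Uniform approximation of a 1-Lipschitz function by twice continuously differentiable
1-Lipschitz functions with bounded second derivative: each of two sliding averages gains one
derivative and preserves the Lipschitz constant. -/
lemma exists_smooth_approx {h : ℝ → ℝ} (hc : Continuous h)
    (hl : ∀ x y, |h x - h y| ≤ |x - y|) {ε : ℝ} (hε : 0 < ε) :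
    ∃ k k1 k2 : ℝ → ℝ, (∀ x, HasDerivAt k (k1 x) x) ∧ (∀ x, HasDerivAt k1 (k2 x) x) ∧
      Continuous k2 ∧ (∀ x, |k1 x| ≤ 1) ∧ (∃ K, ∀ x, |k2 x| ≤ K) ∧ ∀ x, |k x - h x| ≤ 2 * ε := by
  have hquot : ∀ {u : ℝ → ℝ} (_ : ∀ x y, |u x - u y| ≤ |x - y|) (x : ℝ),
      |(u (x + ε) - u x) / ε| ≤ 1 := fun hu x => by
    rw [abs_div, abs_of_pos hε, div_le_one hε]
    simpa [abs_of_pos hε] using hu (x + ε) x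
  have hg := hasDerivAt_slidingAverage hc ε
  have hgc : Continuous (slidingAverage ε h) :=
    continuous_iff_continuousAt.2 fun x => (hg x).continuousAt
  have hgl := abs_sub_le_of_deriv_bound hg (hquot hl)
  refine ⟨slidingAverage ε (slidingAverage ε h), _, _, hasDerivAt_slidingAverage hgc ε,
    fun x => (((hg (x + ε)).comp_add_const x ε).sub (hg x)).div_const ε, by fun_prop, hquot hgl,
    ⟨(1 + 1) / ε, fun x => ?_⟩, fun x => ?_⟩
  · rw [abs_div, abs_of_pos hε]
    gcongr
    exact (abs_sub _ _).trans (add_le_add (hquot hl _) (hquot hl _))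
  · have h1 := abs_slidingAverage_sub_le hgc hgl hε x
    have h2 := abs_slidingAverage_sub_le hc hl hε x
    calc _ ≤ _ := abs_sub_le _ (slidingAverage ε h x) _
      _ ≤ 2 * ε := by linarith

theorem abs_integral_sub_gaussian_le_of_lipschitz {n : ℕ} {𝓧 : Type*} [MeasurableSpace 𝓧]
    (μ : Fin n → Measure 𝓧) [∀ i, IsProbabilityMeasure (μ i)] {F : (Fin n → 𝓧) → ℝ} {M B : ℝ}
    (hF : IsBoundedMeasurable F)
    (hmean : ∫ x, F x ∂(Measure.pi μ) = 0) (hvar : ∫ x, F x ^ 2 ∂(Measure.pi μ) = 1)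
    (hM : ∀ k y y' x, |partialDiff k y y' F x| ≤ M) (hB0 : 0 ≤ B)
    (hB : ∀ l k z z' y y' x, l ≠ k → |partialDiff l z z' (partialDiff k y y' F) x| ≤ B)
    (hn : 1 ≤ n) {h : ℝ → ℝ} (hh : LipschitzWith 1 h) :
    |∫ x, h (F x) ∂(Measure.pi μ) - ∫ z, h z ∂(gaussianReal 0 1)| ≤
      √n * (M ^ 2 + n * (M * B)) + n * M ^ 3 := by
  have hl : ∀ x y, |h x - h y| ≤ |x - y| := fun x y => by
    simpa [Real.dist_eq] using hh.dist_le_mul x y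
  have hgrow : ∀ z, |h z| ≤ |h 0| + |z| := fun z => by
    have h1 := hl z 0
    rw [sub_zero] at h1
    have h2 := abs_add_le (h 0) (h z - h 0)
    rw [add_sub_cancel] at h2
    linarith
  obtain ⟨hFm, A, hFA⟩ := id hF
  refine le_of_forall_pos_le_add fun δ hδ => ?_
  obtain ⟨k, k1, k2, hk, hk1, hk2, hk1b, ⟨K, hK⟩, hkh⟩ :=
    exists_smooth_approx hh.continuous hl (ε := δ / 4) (by linarith)
  have hkc : Continuous k := continuous_iff_continuousAt.2 fun x => (hk x).continuousAt
  have hmain := abs_integral_sub_gaussian_le μ hF hmean hvar hM hB0 hB hn hk hk1 hk2 hk1b hK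
  have hγ : Integrable h (gaussianReal 0 1) :=
    ((integrable_const |h 0|).add integrable_abs_gaussianReal).mono'
      hh.continuous.aestronglyMeasurable (ae_of_all _ hgrow)
  have hγd : Integrable (fun z => k z - h z) (gaussianReal 0 1) :=
    integrable_of_abs_le (hkc.sub hh.continuous).measurable hkh
  have hπ : Integrable (fun x => h (F x)) (Measure.pi μ) :=
    integrable_of_abs_le (hh.continuous.measurable.comp hFm) (A := |h 0| + A) fun x =>
      (hgrow _).trans (by linarith [hFA x])
  have hπd : Integrable (fun x => k (F x) - h (F x)) (Measure.pi μ) :=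
    integrable_of_abs_le ((hkc.sub hh.continuous).measurable.comp hFm) fun x => hkh _
  have e1 : ∫ z, k z ∂(gaussianReal 0 1)
      = ∫ z, h z ∂(gaussianReal 0 1) + ∫ z, (k z - h z) ∂(gaussianReal 0 1) := by
    rw [← integral_add hγ hγd]; simp
  have e2 : ∫ x, k (F x) ∂(Measure.pi μ)
      = ∫ x, h (F x) ∂(Measure.pi μ) + ∫ x, (k (F x) - h (F x)) ∂(Measure.pi μ) := by
    rw [← integral_add hπ hπd]; simp
  have b1 := abs_integral_le_of_abs_le (ρ := gaussianReal 0 1) hkh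
  have b2 := abs_integral_le_of_abs_le (ρ := Measure.pi μ) (fun x => hkh (F x))
  rw [e1, e2] at hmain
  rw [abs_le] at *
  constructor <;> linarith

/-! ### Standardization and the weak interaction bounds -/

section Standardization

variable {n : ℕ} {𝓧 : Type*}

lemma abs_partialDiff_le_seminormM {f : (Fin n → 𝓧) → ℝ} {A : ℝ} (hA : ∀ x, |f x| ≤ A)
    (k : Fin n) (y y' : 𝓧) (x : Fin n → 𝓧) : |partialDiff k y y' f x| ≤ seminormM f := by
  have hbdd : BddAbove {r : ℝ | ∃ (k : Fin n) (x : Fin n → 𝓧) (y y' : 𝓧),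
      r = partialDiff k y y' f x} := by
    refine ⟨A + A, ?_⟩
    rintro r ⟨k, x, y, y', rfl⟩
    exact (le_abs_self _).trans ((abs_sub _ _).trans (add_le_add (hA _) (hA _)))
  refine abs_le'.2 ⟨le_csSup hbdd ⟨k, x, y, y', rfl⟩, le_csSup hbdd ⟨k, x, y', y, ?_⟩⟩
  simp [partialDiff]

lemma mul_abs_partialDiff_partialDiff_le_seminormJ {f : (Fin n → 𝓧) → ℝ} {A : ℝ}
    (hA : ∀ x, |f x| ≤ A) {l k : Fin n} (hlk : l ≠ k) (z z' y y' : 𝓧) (x : Fin n → 𝓧) :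
    n * |partialDiff l z z' (partialDiff k y y' f) x| ≤ seminormJ f := by
  have hbdd : BddAbove {r : ℝ | ∃ (l k : Fin n) (x : Fin n → 𝓧) (z z' y y' : 𝓧), l ≠ k ∧
      r = partialDiff l z z' (partialDiff k y y' f) x} := by
    refine ⟨(A + A) + (A + A), ?_⟩
    rintro r ⟨l, k, x, z, z', y, y', -, rfl⟩
    have h1 : ∀ x, |partialDiff k y y' f x| ≤ A + A := fun x =>
      (abs_sub _ _).trans (add_le_add (hA _) (hA _))
    exact (le_abs_self _).trans ((abs_sub _ _).trans (add_le_add (h1 _) (h1 _)))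
  refine mul_le_mul_of_nonneg_left (abs_le'.2 ⟨le_csSup hbdd ⟨l, k, x, z, z', y, y', hlk, rfl⟩,
    le_csSup hbdd ⟨l, k, x, z', z, y, y', hlk, ?_⟩⟩) n.cast_nonneg
  simp [partialDiff]

lemma seminormJ_nonneg {f : (Fin n → 𝓧) → ℝ} {A : ℝ} (hA : ∀ x, |f x| ≤ A) :
    0 ≤ seminormJ f := by
  by_cases hex : ∃ (l k : Fin n) (_ : Fin n → 𝓧), l ≠ k
  · obtain ⟨l, k, x, hlk⟩ := hex
    exact (by positivity : (0 : ℝ) ≤ _).trans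
      (mul_abs_partialDiff_partialDiff_le_seminormJ hA hlk (x l) (x l) (x l) (x l) x)
  · refine mul_nonneg n.cast_nonneg (Real.sSup_nonneg ?_)
    rintro r ⟨l, k, x, -, -, -, -, hlk, -⟩
    exact absurd ⟨l, k, x, hlk⟩ hex

lemma partialDiff_sub_const (k : Fin n) (y y' : 𝓧) (f : (Fin n → 𝓧) → ℝ) (m : ℝ) :
    partialDiff k y y' (fun x => f x - m) = partialDiff k y y' f := by
  ext x; simp [partialDiff]

lemma partialDiff_mul_const (k : Fin n) (y y' : 𝓧) (f : (Fin n → 𝓧) → ℝ) (r : ℝ) :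
    partialDiff k y y' (fun x => f x * r) = fun x => partialDiff k y y' f x * r := by
  ext x; simp [partialDiff, sub_mul]

variable {Ω : Type*} [MeasurableSpace Ω] [MeasurableSpace 𝓧]

/-- The finite sample bound. The standardized function has first differences at most
`M = (a / n) (n ^ p / C)` and mixed second differences at most `B = (b / n²) (n ^ p / C)`; the
claim is `√n (M² + n M B) + n M³` with `√n` replaced by `n ^ p`, which is where `p ≥ 1 / 2`
enters. -/
theorem distNormal_le (P : Measure Ω) [IsProbabilityMeasure P] {a b C p : ℝ} (hC : 0 < C)
    (hp : 1 / 2 ≤ p) (hn : 1 ≤ n) {X : Fin n → Ω → 𝓧} (hX : ∀ i, Measurable (X i))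
    (hind : iIndepFun X P) {f : (Fin n → 𝓧) → ℝ} (hf : IsBoundedMeasurable f)
    (hw : HasWeakInteractions a b f)
    (hσ : C * (n : ℝ) ^ (-p) ≤ stdDev P (fun ω => f (fun i => X i ω))) :
    distNormal P (fun ω => f (fun i => X i ω)) ≤
      ENNReal.ofReal ((C * a * (a + b) + a ^ 3) / (C ^ 3 * (n : ℝ) ^ (2 - 3 * p))) := by
  obtain ⟨hfm, A, hA⟩ := hf
  have hn0 : (0 : ℝ) < n := by exact_mod_cast hn
  have hn1 : (1 : ℝ) ≤ n := by exact_mod_cast hn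
  set N : ℝ := (n : ℝ) ^ p with hN
  have hN0 : 0 < N := Real.rpow_pos_of_pos hn0 p
  set W : Ω → ℝ := fun ω => f (fun i => X i ω) with hW
  set s := stdDev P W with hs
  set m := ∫ ω, W ω ∂P with hm
  have hsC : C / N ≤ s := by rwa [Real.rpow_neg hn0.le, ← div_eq_mul_inv] at hσ
  have hs0 : 0 < s := (div_pos hC hN0).trans_le hsC
  have hsinv : s⁻¹ ≤ N / C := by
    rw [← inv_div]; exact inv_anti₀ (div_pos hC hN0) hsC
  have : Nonempty Ω := nonempty_of_isProbabilityMeasure P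
  obtain ⟨ω₀⟩ := this
  have ha : 0 ≤ a := by
    have h1 := (abs_nonneg _).trans ((abs_partialDiff_le_seminormM hA ⟨0, hn⟩ (X ⟨0, hn⟩ ω₀)
      (X ⟨0, hn⟩ ω₀) (fun i => X i ω₀)).trans hw.1)
    rwa [le_div_iff₀ hn0, zero_mul] at h1
  have hb : 0 ≤ b := by
    have h1 := (seminormJ_nonneg hA).trans hw.2
    rwa [le_div_iff₀ hn0, zero_mul] at h1
  have hXm : Measurable fun ω i => X i ω := measurable_pi_iff.2 hX
  have hWm : Measurable W := hfm.comp hXm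
  have hmap : P.map (fun ω i => X i ω) = Measure.pi fun i => P.map (X i) :=
    (iIndepFun_iff_map_fun_eq_pi_map fun i => (hX i).aemeasurable).1 hind
  have hprob : ∀ i, IsProbabilityMeasure (P.map (X i)) := fun i =>
    Measure.isProbabilityMeasure_map (hX i).aemeasurable
  set F : (Fin n → 𝓧) → ℝ := fun x => (f x - m) * s⁻¹ with hF
  have hFm : Measurable F := (hfm.sub_const m).mul_const _
  have hFb : ∀ x, |F x| ≤ (A + |m|) * s⁻¹ := fun x => by
    rw [hF, abs_mul, abs_of_pos (inv_pos.2 hs0)]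
    gcongr
    exact (abs_sub _ _).trans (by linarith [hA x])
  have hint : ∀ {g : ℝ → ℝ}, Measurable g →
      ∫ x, g (F x) ∂(Measure.pi fun i => P.map (X i)) = ∫ ω, g ((W ω - m) / s) ∂P := by
    intro g hg
    have hgF : Measurable fun x => g (F x) := hg.comp hFm
    rw [← hmap, integral_map hXm.aemeasurable hgF.aestronglyMeasurable]
    simp only [hF, hW, div_eq_mul_inv]
  have hWint : Integrable W P := integrable_of_abs_le hWm fun ω => hA _
  have hmean : ∫ x, F x ∂(Measure.pi fun i => P.map (X i)) = 0 := by
    rw [hint (g := fun y => y) measurable_id, integral_div, integral_sub hWint (integrable_const _)]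
    simp [hm]
  have hvar : ∫ x, F x ^ 2 ∂(Measure.pi fun i => P.map (X i)) = 1 := by
    rw [hint (g := fun y => y ^ 2) (by fun_prop)]
    simp only [div_pow]
    rw [integral_div, ← variance_eq_integral hWm.aemeasurable, div_eq_one_iff_eq (by positivity),
      hs, stdDev, Real.sq_sqrt (variance_nonneg _ _)]
  have hMF : ∀ k y y' x, |partialDiff k y y' F x| ≤ a / n * (N / C) := fun k y y' x => by
    simp only [hF, partialDiff_mul_const, partialDiff_sub_const, abs_mul,
      abs_of_pos (inv_pos.2 hs0)]
    exact mul_le_mul ((abs_partialDiff_le_seminormM hA k y y' x).trans hw.1) hsinv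
      (inv_pos.2 hs0).le (by positivity)
  have hBF : ∀ l k z z' y y' x, l ≠ k →
      |partialDiff l z z' (partialDiff k y y' F) x| ≤ b / n / n * (N / C) :=
    fun l k z z' y y' x hlk => by
      simp only [hF, partialDiff_mul_const, partialDiff_sub_const, abs_mul,
        abs_of_pos (inv_pos.2 hs0)]
      refine mul_le_mul ?_ hsinv (inv_pos.2 hs0).le (by positivity)
      rw [le_div_iff₀ hn0, mul_comm]
      exact (mul_abs_partialDiff_partialDiff_le_seminormJ hA hlk z z' y y' x).trans hw.2
  have hsqrt : √(n : ℝ) ≤ N := by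
    rw [Real.sqrt_eq_rpow]
    exact Real.rpow_le_rpow_of_exponent_le hn1 hp
  have hpow : (n : ℝ) ^ (2 - 3 * p) = n ^ 2 / N ^ 3 := by
    rw [Real.rpow_sub hn0, hN, ← Real.rpow_natCast, ← Real.rpow_natCast, ← Real.rpow_mul hn0.le]
    norm_num [mul_comm]
  refine iSup₂_le fun h hh => ENNReal.ofReal_le_ofReal ?_
  have hmain := abs_integral_sub_gaussian_le_of_lipschitz (fun i => P.map (X i))
    ⟨hFm, _, hFb⟩ hmean hvar hMF (by positivity) hBF hn hh
  rw [hint hh.continuous.measurable] at hmain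
  refine hmain.trans ?_
  calc _ ≤ N * ((a / n * (N / C)) ^ 2 + n * (a / n * (N / C) * (b / n / n * (N / C))))
        + n * (a / n * (N / C)) ^ 3 := by gcongr
    _ = _ := by
      rw [hpow]
      field_simp

end Standardization

end WeakInteractions

theorem corollary4 {Ω 𝓧 : Type*} [MeasurableSpace Ω] [MeasurableSpace 𝓧]
    (P : MeasureTheory.Measure Ω) [MeasureTheory.IsProbabilityMeasure P]
    (a b C p : ℝ) (hC : 0 < C) (hp : 1 / 2 ≤ p) :
    -- the finite sample bound
    (∀ (n : ℕ), 1 ≤ n →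
      ∀ (X : Fin n → Ω → 𝓧), (∀ i, Measurable (X i)) → ProbabilityTheory.iIndepFun X P →
      ∀ (f : (Fin n → 𝓧) → ℝ), WeakInteractions.IsBoundedMeasurable f →
        WeakInteractions.HasWeakInteractions a b f →
        C * (n : ℝ) ^ (-p) ≤ WeakInteractions.stdDev P (fun ω => f (fun i => X i ω)) →
        WeakInteractions.distNormal P (fun ω => f (fun i => X i ω)) ≤
          ENNReal.ofReal ((C * a * (a + b) + a ^ 3) / (C ^ 3 * (n : ℝ) ^ (2 - 3 * p)))) ∧
    -- asymptotic normality, in the Wasserstein metric, of a sequence of functions when `p < 2 / 3`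
    (p < 2 / 3 →
      ∀ (X : ℕ → Ω → 𝓧), (∀ i, Measurable (X i)) → ProbabilityTheory.iIndepFun X P →
      ∀ (f : (n : ℕ) → (Fin n → 𝓧) → ℝ),
        (∀ n : ℕ, 2 ≤ n → WeakInteractions.IsBoundedMeasurable (f n)) →
        (∀ n : ℕ, 2 ≤ n → WeakInteractions.HasWeakInteractions a b (f n)) →
        (∀ n : ℕ, 2 ≤ n → C * (n : ℝ) ^ (-p) ≤
          WeakInteractions.stdDev P (fun ω => f n (fun i => X i ω))) →
        Filter.Tendsto
          (fun n : ℕ => WeakInteractions.distNormal P (fun ω => f n (fun i => X i ω)))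
          Filter.atTop (nhds 0)) := by
  refine ⟨fun n hn X hX hind f hf hw hσ => WeakInteractions.distNormal_le P hC hp hn hX hind hf hw hσ,
    fun hp' X hX hind f hf hw hσ => ?_⟩
  have hlim : Filter.Tendsto (fun n : ℕ => ENNReal.ofReal
      ((C * a * (a + b) + a ^ 3) / (C ^ 3 * (n : ℝ) ^ (2 - 3 * p)))) Filter.atTop (nhds 0) := by
    rw [← ENNReal.ofReal_zero]
    refine ENNReal.tendsto_ofReal (Filter.Tendsto.const_div_atTop ?_ _)
    exact ((tendsto_rpow_atTop (by linarith)).comp tendsto_natCast_atTop_atTop).const_mul_atTop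
      (by positivity)
  refine tendsto_of_tendsto_of_tendsto_of_le_of_le' tendsto_const_nhds hlim
    (Filter.Eventually.of_forall fun _ => zero_le) ?_
  filter_upwards [Filter.eventually_ge_atTop 2] with n hn
  exact WeakInteractions.distNormal_le P hC hp (by omega) (fun i : Fin n => hX i)
    (hind.precomp Fin.val_injective) (hf n hn) (hw n hn) (hσ n hn)
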